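/- **Proposition 2.2 (equilibrium structure).** Let $\Omega\subset\mathbb R^d$ be a bounded domain (non-empty, open, connected; for instance a bounded Lipschitz domain), let $\varepsilon:\Omega\to[\underline\varepsilon,\overline\varepsilon]$ be measurable with $0<\underline\varepsilon\le\overline\varepsilon<\infty$, and let $E_0>0$. Let $\hat\sigma\in C^2((0,\infty))$ be strictly increasing and uniformly concave on bounded intervals, with $\hat\sigma'(u)\to\infty$ as $u\to0^+$ and $\hat\sigma'(u)\to0$ as $u\to\infty$; put $\hat\sigma(0):=\lim_{u\to0^+}\hat\sigma(u)\in[-\infty,\infty)$. Let $w\in C^2((0,\infty))\cap C([0,\infty))$ be strictly increasing and uniformly concave on bounded intervals, with $w(0)>0$. For non-negative $(n,p,u)\in L^2(\Omega)^3$ (densities of electrons, holes and internal energy), define the total entropy $$\mathcal S(n,p,u)=\int_\Omega\Big(\hat\sigma(u)+n\log w(u)-\lambda(n)+p\log w(u)-\lambda(p)\Big)\,dx\in[-\infty,\infty),\qquad \lambda(s)=s\log s-s+1,\ \lambda(0)=1.$$ The potential $\psi\in H^1(\Omega)$ of $(n,p)$ is the weak solution of $-\operatorname{div}(\varepsilon\nabla\psi)=-n+p$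 in $\Omega$ with $\nu\cdot\nabla\psi=0$ on $\partial\Omega$ and $\int_\Omega\psi\,dx=0$, i.e. $\int_\Omega\varepsilon\nabla\psi\cdot\nabla v\,dx=\int_\Omega(-n+p)v\,dx$ for all $v\in H^1(\Omega)$. A state $(n,p,u)$ is called admissible if it has total charge $\int_\Omega(-n+p)\,dx=0$, its potential $\psi$ exists, and its total energy is $\int_\Omega\big(\tfrac{\varepsilon}{2}|\nabla\psi|^2+u\big)\,dx=E_0$. An equilibrium is an admissible state $(n_\infty,p_\infty,u_\infty)$ that maximizes $\mathcal S$ among all admissible states. Then there is exactly one equilibrium $(n_\infty,p_\infty,u_\infty)$ (up to equality almost everywhere). The functions $n_\infty,p_\infty,u_\infty$ and the equilibrium potential $\psi_\infty$, i.e. the potential of $(n_\infty,p_\infty)$, are constant in $\Omega$ and satisfy $$n_\infty=p_\infty=w(u_\infty),\qquad u_\infty>0,\qquad \psi_\infty=0 .$$ -/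

import Mathlib

open MeasureTheory Set Filter Topology
open scoped ENNReal ContDiff

noncomputable section

namespace Semiconductor

/-- Hypothesis on the thermal entropy `σ : (0, ∞) → ℝ` (values of `σ` outside `(0, ∞)` play no
role). -/
structure IsThermalEntropy (σ : ℝ → ℝ) : Prop where
  contDiffOn : ContDiffOn ℝ 2 σ (Ioi 0)
  strictMonoOn : StrictMonoOn σ (Ioi 0)
  uniformlyConcave : ∀ R > 0, ∃ m > 0, StrongConcaveOn (Ioo 0 R) m σ
  deriv_tendsto_atTop_at_zero : Tendsto (deriv σ) (𝓝[>] 0) atTop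
  deriv_tendsto_zero_at_top : Tendsto (deriv σ) atTop (𝓝 0)

/-- Hypothesis on the energetic equilibrium density `w : [0, ∞) → (0, ∞)` (values of `w` outside
`[0, ∞)` play no role). -/
structure IsEquilibriumDensity (w : ℝ → ℝ) : Prop where
  contDiffOn : ContDiffOn ℝ 2 w (Ioi 0)
  continuousOn : ContinuousOn w (Ici 0)
  strictMonoOn : StrictMonoOn w (Ici 0)
  uniformlyConcave : ∀ R > 0, ∃ m > 0, StrongConcaveOn (Ioo 0 R) m w
  pos_zero : 0 < w 0

/-- The Boltzmann function `λ(s) = s log s - s + 1`, with `λ(0) = 1`. -/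
def boltzmann (s : ℝ) : ℝ := s * Real.log s - s + 1

/-- The thermal entropy on `[0, ∞)`. At `0` an increasing `σ : (0, ∞) → ℝ` is extended by its
limit `lim_{v → 0+} σ(v) = inf_{v > 0} σ(v) ∈ [-∞, ∞)`; the value `-∞` occurs e.g. for the
logarithm. -/
def thermalEntropy (σ : ℝ → ℝ) (u : ℝ) : EReal :=
  if 0 < u then (σ u : EReal) else ⨅ v : Ioi (0 : ℝ), (σ v : EReal)

/-- The entropy density
`S(n, p, u) = σ(u) + (n log w(u) - λ(n)) + (p log w(u) - λ(p))`. -/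
def entropyDensity (σ w : ℝ → ℝ) (n p u : ℝ) : EReal :=
  thermalEntropy σ u +
    (((n * Real.log (w u) - boltzmann n) + (p * Real.log (w u) - boltzmann p) : ℝ) : EReal)

/-- The integral `∫ f⁺ - ∫ f⁻` of an extended real valued function. It is meaningful as soon as one
of the two integrals is finite; for the entropy density of a non-negative square integrable
state on a bounded set, the integral of the positive part always is. -/
def extIntegral {α : Type*} [MeasurableSpace α] (μ : Measure α) (f : α → EReal) : EReal :=
  ((∫⁻ x, (f x).toENNReal ∂μ : ℝ≥0∞) : EReal) - ((∫⁻ x, (-f x).toENNReal ∂μ : ℝ≥0∞) : EReal)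

variable {d : ℕ}

/-- The total entropy `∫_Ω S(n, p, u) dx ∈ [-∞, ∞)`. -/
def totalEntropy (Ω : Set (EuclideanSpace ℝ (Fin d))) (σ w : ℝ → ℝ)
    (n p u : EuclideanSpace ℝ (Fin d) → ℝ) : EReal :=
  extIntegral (volume.restrict Ω) fun x => entropyDensity σ w (n x) (p x) (u x)

/-- `f ∈ L²(Ω)` and `f ≥ 0` almost everywhere. -/
def MemL2Nonneg (Ω : Set (EuclideanSpace ℝ (Fin d))) (f : EuclideanSpace ℝ (Fin d) → ℝ) : Prop :=
  MemLp f 2 (volume.restrict Ω) ∧ ∀ᵐ x ∂volume.restrict Ω, 0 ≤ f x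

/-- `f ∈ H¹(Ω)` with weak gradient `G ∈ L²(Ω)ᵈ`. -/
structure HasWeakGradient (Ω : Set (EuclideanSpace ℝ (Fin d)))
    (f : EuclideanSpace ℝ (Fin d) → ℝ)
    (G : EuclideanSpace ℝ (Fin d) → EuclideanSpace ℝ (Fin d)) : Prop where
  memLp : MemLp f 2 (volume.restrict Ω)
  memLp_grad : MemLp G 2 (volume.restrict Ω)
  integral_eq : ∀ φ : EuclideanSpace ℝ (Fin d) → ℝ, ContDiff ℝ ∞ φ → HasCompactSupport φ →
    tsupport φ ⊆ Ω → ∀ e : EuclideanSpace ℝ (Fin d),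
      ∫ x in Ω, f x * fderiv ℝ φ x e = -∫ x in Ω, inner ℝ (G x) e * φ x

/-- `ψ ∈ H¹(Ω)`, with weak gradient `G`, is the weak solution of Poisson's equation
`-div (ε ∇ψ) = -n + p` in `Ω` with homogeneous Neumann boundary conditions and `∫_Ω ψ dx = 0`. -/
structure IsPotential (Ω : Set (EuclideanSpace ℝ (Fin d))) (ε n p : EuclideanSpace ℝ (Fin d) → ℝ)
    (ψ : EuclideanSpace ℝ (Fin d) → ℝ)
    (G : EuclideanSpace ℝ (Fin d) → EuclideanSpace ℝ (Fin d)) : Prop where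
  hasWeakGradient : HasWeakGradient Ω ψ G
  weak_eq : ∀ (v : EuclideanSpace ℝ (Fin d) → ℝ)
    (V : EuclideanSpace ℝ (Fin d) → EuclideanSpace ℝ (Fin d)), HasWeakGradient Ω v V →
      ∫ x in Ω, ε x * inner ℝ (G x) (V x) = ∫ x in Ω, (-n x + p x) * v x
  mean_zero : ∫ x in Ω, ψ x = 0

/-- The state `(n, p, u) ∈ L²₊(Ω)³` has total charge `∫_Ω (-n + p) dx = 0` and total energy
`∫_Ω (ε/2 |∇ψ|² + u) dx = E₀`, where `ψ` is the potential generated by `(n, p)`. -/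
structure IsAdmissible (Ω : Set (EuclideanSpace ℝ (Fin d))) (ε : EuclideanSpace ℝ (Fin d) → ℝ)
    (E₀ : ℝ) (n p u : EuclideanSpace ℝ (Fin d) → ℝ) : Prop where
  memL2_n : MemL2Nonneg Ω n
  memL2_p : MemL2Nonneg Ω p
  memL2_u : MemL2Nonneg Ω u
  charge : ∫ x in Ω, (-n x + p x) = 0
  energy : ∃ ψ G, IsPotential Ω ε n p ψ G ∧ ∫ x in Ω, (ε x / 2 * ‖G x‖ ^ 2 + u x) = E₀

/-- `(n, p, u)` is an equilibrium: it maximizes the total entropy among all states of total charge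
`0` and total energy `E₀`. -/
structure IsEquilibrium (Ω : Set (EuclideanSpace ℝ (Fin d))) (ε : EuclideanSpace ℝ (Fin d) → ℝ)
    (σ w : ℝ → ℝ) (E₀ : ℝ) (n p u : EuclideanSpace ℝ (Fin d) → ℝ) : Prop where
  admissible : IsAdmissible Ω ε E₀ n p u
  eq_sSup : totalEntropy Ω σ w n p u =
    sSup {s | ∃ n' p' u', IsAdmissible Ω ε E₀ n' p' u' ∧ s = totalEntropy Ω σ w n' p' u'}

end Semiconductor

end

/-! Put `U = E₀ / |Ω|` and `k = σ'(U) + 2 w'(U) ≥ 0`. For fixed `u`, each carrier term `s log w(u) -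
λ(s)` is at most `w(u) - 1`, with equality only at `s = w(u)`. What remains, `σ(u) + 2 w(u) - 2`, is
strictly concave and lies below its tangent at `U`. So the entropy density is at most an affine
function of `u` with slope `k`, strictly unless `n = p = w(U)` and `u = U` (`entropyDensity_lt`).
The field energy is non-negative, hence `∫ u ≤ E₀`; as `k ≥ 0`, integrating the affine bound gives
at most `|Ω| (σ(U) + 2 w(U) - 2)`, the entropy of the constant state. A maximizer attains the bound
almost everywhere (`ae_eq_of_integral_le_extIntegral`), so it is that state. Its charge density
vanishes, so its potential has zero gradient, is constant by connectedness, and is zero by its mean.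
-/

namespace Semiconductor

/-! ### Extended integrals and the equality case of comparison -/

section ExtIntegral

lemma eq_of_toENNReal_eq_of_toENNReal_neg_eq {x y : EReal} (h : x.toENNReal = y.toENNReal)
    (h' : (-x).toENNReal = (-y).toENNReal) : x = y := by
  rcases le_total 0 x with hx | hx
  · rcases le_total 0 y with hy | hy
    · exact (EReal.toENNReal_eq_toENNReal hx hy).1 h
    · have hx0 : x = 0 :=
        le_antisymm (EReal.toENNReal_eq_zero_iff.1 (h.trans (EReal.toENNReal_of_nonpos hy))) hx
      rw [hx0, neg_zero, EReal.toENNReal_zero, eq_comm, EReal.toENNReal_eq_zero_iff,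
        EReal.neg_le, neg_zero] at h'
      rw [hx0]
      exact le_antisymm h' hy
  · rcases le_total 0 y with hy | hy
    · have hy0 : y = 0 := le_antisymm
        (EReal.toENNReal_eq_zero_iff.1 (h.symm.trans (EReal.toENNReal_of_nonpos hx))) hy
      rw [hy0, neg_zero, EReal.toENNReal_zero, EReal.toENNReal_eq_zero_iff,
        EReal.neg_le, neg_zero] at h'
      rw [hy0]
      exact le_antisymm hx h'
    · exact neg_injective ((EReal.toENNReal_eq_toENNReal
        (by simpa using EReal.neg_le_neg_iff.2 hx) (by simpa using EReal.neg_le_neg_iff.2 hy)).1 h')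

variable {α : Type*} [MeasurableSpace α] {μ : Measure α} {f : α → EReal} {g : α → ℝ}

lemma lintegral_toENNReal_coe_ne_top (hg : Integrable g μ) :
    ∫⁻ x, (g x : EReal).toENNReal ∂μ ≠ ⊤ := by
  simpa using (hg.lintegral_lt_top).ne

lemma extIntegral_coe (hg : Integrable g μ) :
    extIntegral μ (fun x => (g x : EReal)) = ((∫ x, g x ∂μ : ℝ) : EReal) := by
  have h1 := lintegral_toENNReal_coe_ne_top hg
  have h2 := lintegral_toENNReal_coe_ne_top hg.neg
  rw [extIntegral, integral_eq_lintegral_pos_part_sub_lintegral_neg_part hg, EReal.coe_sub]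
  congr 1
  · rw [EReal.coe_ennreal_toReal (by simpa using h1)]
    simp
  · rw [EReal.coe_ennreal_toReal (by simpa using h2)]
    congr 1

lemma extIntegral_le_of_ae_le (hg : Integrable g μ) (hfg : ∀ᵐ x ∂μ, f x ≤ g x) :
    extIntegral μ f ≤ ((∫ x, g x ∂μ : ℝ) : EReal) := by
  rw [← extIntegral_coe hg]
  refine EReal.sub_le_sub ?_ ?_ <;> refine EReal.coe_ennreal_le_coe_ennreal_iff.2 ?_
  · exact lintegral_mono_ae (hfg.mono fun x hx => EReal.toENNReal_le_toENNReal hx)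
  · exact lintegral_mono_ae
      (hfg.mono fun x hx => EReal.toENNReal_le_toENNReal (EReal.neg_le_neg_iff.2 hx))

/-- A function below an integrable one has the same extended integral only if the two agree. -/
lemma ae_eq_of_integral_le_extIntegral (hf : AEMeasurable f μ) (hg : Integrable g μ)
    (hfg : ∀ᵐ x ∂μ, f x ≤ g x) (h : ((∫ x, g x ∂μ : ℝ) : EReal) ≤ extIntegral μ f) :
    ∀ᵐ x ∂μ, f x = g x := by
  have hP := lintegral_toENNReal_coe_ne_top hg
  have hN : ∫⁻ x, (-(g x : EReal)).toENNReal ∂μ ≠ ⊤ := lintegral_toENNReal_coe_ne_top hg.neg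
  have hpos : (fun x => (f x).toENNReal) ≤ᵐ[μ] fun x => (g x : EReal).toENNReal :=
    hfg.mono fun x hx => EReal.toENNReal_le_toENNReal hx
  have hneg : (fun x => (-(g x : EReal)).toENNReal) ≤ᵐ[μ] fun x => (-f x).toENNReal :=
    hfg.mono fun x hx => EReal.toENNReal_le_toENNReal (EReal.neg_le_neg_iff.2 hx)
  have hAP := lintegral_mono_ae hpos
  have hNB := lintegral_mono_ae hneg
  have hA := ne_top_of_le_ne_top hP hAP
  rw [← extIntegral_coe hg] at h
  unfold extIntegral at h
  -- An infinite negative part would make the extended integral `-∞`, below the finite integral of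
  -- `g`.
  have hB : ∫⁻ x, (-f x).toENNReal ∂μ ≠ ⊤ := by
    intro hB
    rw [hB, EReal.coe_ennreal_top, EReal.sub_top, le_bot_iff, ← EReal.coe_ennreal_toReal hP,
      ← EReal.coe_ennreal_toReal hN, ← EReal.coe_sub] at h
    exact EReal.coe_ne_bot _ h
  rw [← EReal.coe_ennreal_toReal hP, ← EReal.coe_ennreal_toReal hN,
    ← EReal.coe_ennreal_toReal hA, ← EReal.coe_ennreal_toReal hB, ← EReal.coe_sub,
    ← EReal.coe_sub, EReal.coe_le_coe_iff] at h
  have hAP' := (ENNReal.toReal_le_toReal hA hP).2 hAP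
  have hNB' := (ENNReal.toReal_le_toReal hN hB).2 hNB
  -- Positive parts are ordered one way and negative parts the other, so `h` forces equality of both
  -- integrals.
  have e1 := ae_eq_of_ae_le_of_lintegral_le hpos hA hg.1.aemeasurable.coe_real_ereal.ereal_toENNReal
    ((ENNReal.toReal_le_toReal hP hA).1 (by linarith))
  have e2 := ae_eq_of_ae_le_of_lintegral_le hneg hN (measurable_neg.comp_aemeasurable hf).ereal_toENNReal
    ((ENNReal.toReal_le_toReal hB hN).1 (by linarith))
  filter_upwards [e1, e2] with x h1 h2
  exact eq_of_toENNReal_eq_of_toENNReal_neg_eq h1 h2.symm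

end ExtIntegral

/-! ### Pointwise tangent bounds for the entropy density -/

section Concave

/-- Adding `m / 2 * x ^ 2` leaves a concave function, whose chord slopes compare with its derivative
at `x`. -/
lemma le_tangent_of_strongConcaveOn {s : Set ℝ} {m f' x y : ℝ} {f : ℝ → ℝ}
    (hf : StrongConcaveOn s m f) (hx : x ∈ s) (hy : y ∈ s) (hf' : HasDerivAt f f' x) :
    f y ≤ f x + f' * (y - x) - m / 2 * (y - x) ^ 2 := by
  have hc := strongConcaveOn_iff_convex.1 hf
  have hd : HasDerivAt (fun z => f z + m / 2 * ‖z‖ ^ 2) (f' + m * x) x := by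
    simp only [Real.norm_eq_abs, sq_abs]
    exact (hf'.fun_add ((hasDerivAt_pow 2 x).const_mul (m / 2))).congr_deriv (by norm_num; ring)
  have key : f y + m / 2 * ‖y‖ ^ 2 ≤ f x + m / 2 * ‖x‖ ^ 2 + (f' + m * x) * (y - x) := by
    rcases lt_trichotomy x y with h | h | h
    · have := hc.slope_le_of_hasDerivAt hx hy h hd
      rw [slope_def_field, div_le_iff₀ (sub_pos.2 h)] at this
      linarith
    · simp [h]
    · have := hc.le_slope_of_hasDerivAt hy hx h hd
      rw [slope_def_field, le_div_iff₀ (sub_pos.2 h)] at this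
      linarith
  simp only [Real.norm_eq_abs, sq_abs] at key
  linarith

variable {σ w : ℝ → ℝ}

lemma deriv_nonneg_of_strictMonoOn {f : ℝ → ℝ} (hf : StrictMonoOn f (Ioi 0)) {x : ℝ}
    (hx : 0 < x) : 0 ≤ deriv f x := by
  rw [← derivWithin_of_isOpen isOpen_Ioi (mem_Ioi.2 hx)]
  exact hf.monotoneOn.derivWithin_nonneg

lemma hasDerivAt_of_contDiffOn {f : ℝ → ℝ} (hf : ContDiffOn ℝ 2 f (Ioi 0)) {x : ℝ}
    (hx : 0 < x) : HasDerivAt f (deriv f x) x :=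
  ((hf.differentiableOn (by norm_num)).differentiableAt (Ioi_mem_nhds hx)).hasDerivAt

/-- The entropy of a state with `n = p = w(u)` is bounded by its linearization at `U > 0`, with
a quadratic gain on bounded intervals. -/
lemma IsThermalEntropy.exists_le_tangent (hσ : IsThermalEntropy σ) (hw : IsEquilibriumDensity w)
    {U : ℝ} (hU : 0 < U) (R : ℝ) :
    ∃ m > 0, ∀ u ∈ Ioo 0 R, σ u + 2 * w u ≤
      σ U + 2 * w U + (deriv σ U + 2 * deriv w U) * (u - U) - m * (u - U) ^ 2 := by
  -- The interval is enlarged so that it also contains the point of tangency `U`.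
  have hR : 0 < max R (U + 1) := lt_max_of_lt_right (by linarith)
  have hUR : U ∈ Ioo 0 (max R (U + 1)) := ⟨hU, lt_max_of_lt_right (by linarith)⟩
  obtain ⟨m₁, hm₁, h₁⟩ := hσ.uniformlyConcave _ hR
  obtain ⟨m₂, hm₂, h₂⟩ := hw.uniformlyConcave _ hR
  refine ⟨m₁ / 2 + m₂, by positivity, fun u hu => ?_⟩
  have hu' : u ∈ Ioo 0 (max R (U + 1)) := ⟨hu.1, hu.2.trans_le (le_max_left _ _)⟩
  have k₁ := le_tangent_of_strongConcaveOn h₁ hUR hu' (hasDerivAt_of_contDiffOn hσ.contDiffOn hU)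
  have k₂ := le_tangent_of_strongConcaveOn h₂ hUR hu' (hasDerivAt_of_contDiffOn hw.contDiffOn hU)
  linarith

lemma IsThermalEntropy.lt_tangent (hσ : IsThermalEntropy σ) (hw : IsEquilibriumDensity w)
    {U u : ℝ} (hU : 0 < U) (hu : 0 ≤ u) (hne : u ≠ U) :
    thermalEntropy σ u < ((σ U + 2 * w U + (deriv σ U + 2 * deriv w U) * (u - U)
      - 2 * w u : ℝ) : EReal) := by
  rcases hu.eq_or_lt with rfl | hu
  · obtain ⟨m, hm, h⟩ := hσ.exists_le_tangent hw hU 1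
    rw [thermalEntropy, if_neg (lt_irrefl _)]
    have hle : ∀ v ∈ Ioi (0 : ℝ), (⨅ v : Ioi (0 : ℝ), (σ v : EReal)) ≤ σ v :=
      fun v hv => iInf_le (fun v : Ioi (0 : ℝ) => (σ v : EReal)) ⟨v, hv⟩
    generalize (⨅ v : Ioi (0 : ℝ), (σ v : EReal)) = s at hle
    induction s with
    | bot => exact EReal.bot_lt_coe _
    | top => exact absurd (top_le_iff.1 (hle 1 (mem_Ioi.2 one_pos))) (EReal.coe_ne_top _)
    | coe s =>
      rw [EReal.coe_lt_coe_iff]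
      -- If the limit at `0` is finite, the bound passes to the limit `v → 0+`; the quadratic gain,
      -- positive at `0`, keeps it strict.
      have hcont : Tendsto (fun u => σ U + 2 * w U + (deriv σ U + 2 * deriv w U) * (u - U)
          - m * (u - U) ^ 2) (𝓝[>] 0) (𝓝 (σ U + 2 * w U +
            (deriv σ U + 2 * deriv w U) * (0 - U) - m * (0 - U) ^ 2)) :=
        (Continuous.tendsto (by fun_prop) 0).mono_left nhdsWithin_le_nhds
      have : s + 2 * w 0 ≤ σ U + 2 * w U + (deriv σ U + 2 * deriv w U) * (0 - U)
          - m * (0 - U) ^ 2 := by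
        refine ge_of_tendsto hcont ?_
        filter_upwards [Ioo_mem_nhdsGT (zero_lt_one' ℝ)] with v hv
        have h1 := EReal.coe_le_coe_iff.1 (hle v hv.1)
        have h2 := hw.strictMonoOn self_mem_Ici (mem_Ici.2 hv.1.le) hv.1
        linarith [h v hv]
      have : 0 < m * (0 - U) ^ 2 := by rw [zero_sub, neg_sq]; positivity
      linarith
  · obtain ⟨m, hm, h⟩ := hσ.exists_le_tangent hw hU (u + 1)
    have := h u ⟨hu, by linarith⟩
    have : 0 < m * (u - U) ^ 2 := by have := sub_ne_zero.2 hne; positivity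
    rw [thermalEntropy, if_pos hu, EReal.coe_lt_coe_iff]
    linarith

/-- This is `log t < t - 1` for `t = a / s ≠ 1`, multiplied by `s`. -/
lemma mul_log_sub_boltzmann_lt {a s : ℝ} (ha : 0 < a) (hs : 0 ≤ s) (hne : s ≠ a) :
    s * Real.log a - boltzmann s < a - 1 := by
  unfold boltzmann
  rcases hs.eq_or_lt with rfl | hs
  · simp [ha]
  · have h := Real.log_lt_sub_one_of_pos (div_pos ha hs)
      (by rw [Ne, div_eq_one_iff_eq hs.ne']; exact hne.symm)
    rw [Real.log_div ha.ne' hs.ne'] at h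
    have := mul_lt_mul_of_pos_left h hs
    have e : s * (a / s - 1) = a - s := by field_simp
    rw [e] at this
    linarith

lemma mul_log_sub_boltzmann_self (a : ℝ) : a * Real.log a - boltzmann a = a - 1 := by
  unfold boltzmann; ring

lemma mul_log_sub_boltzmann_le {a s : ℝ} (ha : 0 < a) (hs : 0 ≤ s) :
    s * Real.log a - boltzmann s ≤ a - 1 := by
  rcases eq_or_ne s a with rfl | h
  · exact (mul_log_sub_boltzmann_self s).le
  · exact (mul_log_sub_boltzmann_lt ha hs h).le

lemma IsEquilibriumDensity.pos (hw : IsEquilibriumDensity w) {u : ℝ} (hu : 0 ≤ u) : 0 < w u :=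
  hw.pos_zero.trans_le (hw.strictMonoOn.monotoneOn self_mem_Ici hu hu)

lemma entropyDensity_equilibrium {U : ℝ} (hU : 0 < U) :
    entropyDensity σ w (w U) (w U) U = ((σ U + 2 * w U - 2 : ℝ) : EReal) := by
  rw [entropyDensity, thermalEntropy, if_pos hU, mul_log_sub_boltzmann_self, ← EReal.coe_add]
  congr 1
  ring

lemma IsThermalEntropy.entropyDensity_lt (hσ : IsThermalEntropy σ) (hw : IsEquilibriumDensity w)
    {U n p u : ℝ} (hU : 0 < U) (hn : 0 ≤ n) (hp : 0 ≤ p) (hu : 0 ≤ u)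
    (hne : ¬(n = w U ∧ p = w U ∧ u = U)) :
    entropyDensity σ w n p u <
      ((σ U + 2 * w U - 2 + (deriv σ U + 2 * deriv w U) * (u - U) : ℝ) : EReal) := by
  have hwu := hw.pos hu
  unfold entropyDensity
  rcases eq_or_ne u U with rfl | h
  · rw [thermalEntropy, if_pos hU, ← EReal.coe_add, EReal.coe_lt_coe_iff, sub_self, mul_zero]
    have h1 := mul_log_sub_boltzmann_le hwu hn
    have h2 := mul_log_sub_boltzmann_le hwu hp
    by_cases hn' : n = w u
    · have := mul_log_sub_boltzmann_lt hwu hp fun h => hne ⟨hn', h, rfl⟩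
      linarith
    · have := mul_log_sub_boltzmann_lt hwu hn hn'
      linarith
  · refine (EReal.add_lt_add_of_lt_of_le' (hσ.lt_tangent hw hU hu h)
      (EReal.coe_le_coe_iff.2 (add_le_add (mul_log_sub_boltzmann_le hwu hn)
        (mul_log_sub_boltzmann_le hwu hp))) (EReal.coe_ne_bot _)
        (fun h => absurd h (EReal.coe_ne_top _))).trans_le ?_
    rw [← EReal.coe_add, EReal.coe_le_coe_iff]
    linarith

lemma IsThermalEntropy.entropyDensity_le (hσ : IsThermalEntropy σ) (hw : IsEquilibriumDensity w)
    {U n p u : ℝ} (hU : 0 < U) (hn : 0 ≤ n) (hp : 0 ≤ p) (hu : 0 ≤ u) :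
    entropyDensity σ w n p u ≤
      ((σ U + 2 * w U - 2 + (deriv σ U + 2 * deriv w U) * (u - U) : ℝ) : EReal) := by
  by_cases h : n = w U ∧ p = w U ∧ u = U
  · obtain ⟨rfl, rfl, rfl⟩ := h
    rw [entropyDensity_equilibrium hU, sub_self, mul_zero, add_zero]
  · exact (hσ.entropyDensity_lt hw hU hn hp hu h).le

lemma IsThermalEntropy.monotone_thermalEntropy (hσ : IsThermalEntropy σ) :
    Monotone (thermalEntropy σ) := by
  intro a b hab
  unfold thermalEntropy
  split_ifs with ha hb hb
  · exact EReal.coe_le_coe_iff.2 (hσ.strictMonoOn.monotoneOn ha hb hab)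
  · exact absurd (ha.trans_le hab) hb
  · exact iInf_le (fun v : Ioi (0 : ℝ) => (σ v : EReal)) ⟨b, hb⟩
  · exact le_rfl

lemma IsThermalEntropy.aemeasurable_entropyDensity (hσ : IsThermalEntropy σ)
    (hw : IsEquilibriumDensity w) {α : Type*} [MeasurableSpace α] {μ : Measure α}
    {n p u : α → ℝ} (hn : AEMeasurable n μ) (hp : AEMeasurable p μ) (hu : AEMeasurable u μ)
    (hu0 : ∀ᵐ x ∂μ, 0 ≤ u x) :
    AEMeasurable (fun x => entropyDensity σ w (n x) (p x) (u x)) μ := by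
  -- Since `w` is controlled only on `[0, ∞)`, truncation gives a monotone, hence Borel, function on
  -- the whole line.
  have hmono : Monotone fun v => w (max v 0) := fun a b hab =>
    hw.strictMonoOn.monotoneOn (mem_Ici.2 (le_max_right _ _)) (mem_Ici.2 (le_max_right _ _))
      (max_le_max_right 0 hab)
  have hwu : AEMeasurable (fun x => Real.log (w (u x))) μ :=
    (Real.measurable_log.comp_aemeasurable (hmono.measurable.comp_aemeasurable hu)).congr
      (hu0.mono fun x hx => by simp [max_eq_left hx])
  have hb : Measurable boltzmann := by unfold boltzmann; fun_prop
  exact (hσ.monotone_thermalEntropy.measurable.comp_aemeasurable hu).add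
    (((hn.mul hwu).sub (hb.comp_aemeasurable hn)).add
      ((hp.mul hwu).sub (hb.comp_aemeasurable hp))).coe_real_ereal

end Concave

/-! ### Functions with vanishing weak gradient -/

section WeakGradient

variable {d : ℕ} {Ω : Set (EuclideanSpace ℝ (Fin d))} {f : EuclideanSpace ℝ (Fin d) → ℝ}
  {G : EuclideanSpace ℝ (Fin d) → EuclideanSpace ℝ (Fin d)}

open scoped Convolution in
-- The derivative falls on the mollifier, and `y ↦ φ (x - y)` is a test function supported in `Ω`,
-- so the weak gradient can be inserted.
lemma HasWeakGradient.fderiv_convolution_eq_zero (hΩ : MeasurableSet Ω)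
    (hf : HasWeakGradient Ω f G) (hG : ∀ᵐ x ∂volume.restrict Ω, G x = 0)
    (hint : Integrable (Ω.indicator f)) {φ : EuclideanSpace ℝ (Fin d) → ℝ} {r : ℝ}
    (hφ : ContDiff ℝ ∞ φ) (hφc : HasCompactSupport φ) (hφr : tsupport φ ⊆ Metric.closedBall 0 r)
    {x : EuclideanSpace ℝ (Fin d)} (hx : Metric.closedBall x r ⊆ Ω) :
    HasFDerivAt (φ ⋆[ContinuousLinearMap.lsmul ℝ ℝ, volume] (Ω.indicator f))
      (0 : EuclideanSpace ℝ (Fin d) →L[ℝ] ℝ) x := by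
  set L := ContinuousLinearMap.lsmul ℝ ℝ (E := ℝ)
  have hφ1 : ContDiff ℝ 1 φ := hφ.of_le (by exact_mod_cast le_top)
  have h := hφc.hasFDerivAt_convolution_left (μ := volume) L hφ1 hint.locallyIntegrable x
  refine h.congr_fderiv ?_
  ext e
  have hex := (hφc.fderiv ℝ).convolutionExists_left (L.precompL (EuclideanSpace ℝ (Fin d)))
    (hφ1.continuous_fderiv one_ne_zero) hint.locallyIntegrable x
  have hφx : ContDiff ℝ ∞ fun y => φ (x - y) := hφ.comp (contDiff_const.sub contDiff_id)
  have hsupp : tsupport (fun y => φ (x - y)) ⊆ Metric.closedBall x r := by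
    refine closure_minimal (fun y hy => ?_) Metric.isClosed_closedBall
    have := hφr (subset_tsupport φ hy)
    rwa [mem_closedBall_zero_iff, ← dist_eq_norm, dist_comm] at this
  have hcs : HasCompactSupport fun y => φ (x - y) :=
    HasCompactSupport.of_support_subset_isCompact (isCompact_closedBall x r)
      ((subset_tsupport _).trans hsupp)
  have key := hf.integral_eq _ hφx hcs (hsupp.trans hx) e
  have hz : ∫ y in Ω, inner ℝ (G y) e * φ (x - y) = 0 := by
    rw [integral_congr_ae (g := fun _ => (0 : ℝ)) (hG.mono fun y hy => by simp [hy]),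
      integral_zero]
  have hfd (y : EuclideanSpace ℝ (Fin d)) :
      fderiv ℝ (fun y => φ (x - y)) y e = -fderiv ℝ φ (x - y) e := by
    have h1 : HasFDerivAt (fun y => x - y)
        (-ContinuousLinearMap.id ℝ (EuclideanSpace ℝ (Fin d))) y :=
      (hasFDerivAt_id y).const_sub x
    have h2 := (hφ1.differentiable one_ne_zero (x - y)).hasFDerivAt.comp y h1
    have h3 : fderiv ℝ (fun y => φ (x - y)) y = _ := h2.fderiv
    rw [h3]
    simp
  rw [hz, neg_zero] at key
  simp only [hfd, mul_neg, integral_neg, neg_eq_zero] at key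
  rw [convolution_eq_swap, ContinuousLinearMap.integral_apply]
  · simp only [ContinuousLinearMap.precompL_apply, _root_.zero_apply]
    rw [← key, ← integral_indicator hΩ]
    refine integral_congr_ae (Eventually.of_forall fun y => ?_)
    by_cases hy : y ∈ Ω <;> simp [L, hy, mul_comm]
  · have := hex.integrable_swap
    simpa using this

open scoped Convolution in
lemma HasWeakGradient.exists_ae_eq_const_ball (hΩ : IsOpen Ω) (hf : HasWeakGradient Ω f G)
    (hG : ∀ᵐ x ∂volume.restrict Ω, G x = 0) (hint : Integrable (Ω.indicator f))
    {x₀ : EuclideanSpace ℝ (Fin d)} (hx₀ : x₀ ∈ Ω) :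
    ∃ r > 0, ∃ c, Metric.ball x₀ r ⊆ Ω ∧
      ∀ᵐ x ∂volume.restrict (Metric.ball x₀ r), f x = c := by
  obtain ⟨R, hR, hball⟩ := Metric.isOpen_iff.1 hΩ x₀ hx₀
  have hR2 : 0 < R / 2 := by positivity
  have hsub : Metric.ball x₀ (R / 2) ⊆ Ω := (Metric.ball_subset_ball (by linarith)).trans hball
  refine ⟨R / 2, hR2, ?_⟩
  -- Outer radii at most `R / 4` keep the supports inside the ball of radius `R`; the radius ratio 2
  -- gives almost everywhere convergence of the mollifications, which are constant on the half ball.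
  let φ : ℕ → ContDiffBump (0 : EuclideanSpace ℝ (Fin d)) := fun k =>
    ⟨R / 4 / (k + 1) / 2, R / 4 / (k + 1), by positivity, half_lt_self (by positivity)⟩
  have hlim : Tendsto (fun k => (φ k).rOut) atTop (𝓝 0) := by
    have := tendsto_one_div_add_atTop_nhds_zero_nat.const_mul (R / 4)
    simp only [mul_zero, mul_one_div] at this
    exact this
  have hconv := ContDiffBump.ae_convolution_tendsto_right_of_locallyIntegrable (μ := volume)
    (φ := φ) (K := 2) hlim
    (Eventually.of_forall fun k => by simp only [φ]; linarith) hint.locallyIntegrable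
  have hconst : ∀ k, ∀ x ∈ Metric.ball x₀ (R / 2),
      ((φ k).normed volume ⋆[ContinuousLinearMap.lsmul ℝ ℝ, volume] (Ω.indicator f)) x =
      ((φ k).normed volume ⋆[ContinuousLinearMap.lsmul ℝ ℝ, volume] (Ω.indicator f)) x₀ := by
    intro k x hx
    have hrk : (φ k).rOut ≤ R / 4 :=
      div_le_self (by positivity) (by linarith [(Nat.cast_nonneg k : (0 : ℝ) ≤ k)])
    have hd : ∀ y ∈ Metric.ball x₀ (R / 2),
        HasFDerivAt ((φ k).normed volume ⋆[ContinuousLinearMap.lsmul ℝ ℝ, volume]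
          (Ω.indicator f)) (0 : EuclideanSpace ℝ (Fin d) →L[ℝ] ℝ) y := fun y hy =>
      hf.fderiv_convolution_eq_zero hΩ.measurableSet hG hint (ContDiffBump.contDiff_normed _)
        (ContDiffBump.hasCompactSupport_normed _) (ContDiffBump.tsupport_normed_eq _).subset
        ((Metric.closedBall_subset_ball' (by
          have := Metric.mem_ball.1 hy; linarith)).trans hball)
    exact (convex_ball x₀ (R / 2)).is_const_of_fderivWithin_eq_zero (𝕜 := ℝ)
      (fun y hy => (hd y hy).differentiableAt.differentiableWithinAt)
      (fun y hy => by
        rw [fderivWithin_of_isOpen Metric.isOpen_ball hy, (hd y hy).fderiv])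
      hx (Metric.mem_ball_self hR2)
  have hae : ∀ᵐ x ∂volume.restrict (Metric.ball x₀ (R / 2)),
      Tendsto (fun k => ((φ k).normed volume ⋆[ContinuousLinearMap.lsmul ℝ ℝ, volume]
        (Ω.indicator f)) x₀) atTop (𝓝 (f x)) := by
    filter_upwards [ae_restrict_of_ae hconv, ae_restrict_mem measurableSet_ball] with x hx hxb
    rw [indicator_of_mem (hsub hxb)] at hx
    simpa only [hconst _ x hxb] using hx
  have : NeZero (volume.restrict (Metric.ball x₀ (R / 2))) :=
    ⟨by rw [Ne, Measure.restrict_eq_zero]; exact (Metric.measure_ball_pos _ _ hR2).ne'⟩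
  obtain ⟨z, hz⟩ := hae.exists
  exact ⟨f z, hsub, hae.mono fun x hx => tendsto_nhds_unique hx hz⟩

/-- A function on a connected open set with vanishing weak gradient is constant. -/
lemma HasWeakGradient.exists_ae_eq_const (hΩ : IsOpen Ω) (hconn : IsConnected Ω)
    (hf : HasWeakGradient Ω f G) (hG : ∀ᵐ x ∂volume.restrict Ω, G x = 0)
    (hint : IntegrableOn f Ω) : ∃ c, ∀ᵐ x ∂volume.restrict Ω, f x = c := by
  have hloc := fun x (hx : x ∈ Ω) => hf.exists_ae_eq_const_ball hΩ hG
    (hint.integrable_indicator hΩ.measurableSet) hx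
  obtain ⟨x₀, hx₀⟩ := hconn.nonempty
  obtain ⟨r₀, hr₀, c, -, h₀⟩ := hloc x₀ hx₀
  -- `A S` collects the points near which `f` is almost everywhere a constant from `S`. The sets for
  -- `{c}` and its complement are open, disjoint and cover `Ω`.
  let A : Set ℝ → Set (EuclideanSpace ℝ (Fin d)) := fun S =>
    ⋃ c ∈ S, {x | ∃ r > 0, ∀ᵐ y ∂volume.restrict (Metric.ball x r), f y = c}
  have hopen : ∀ S, IsOpen (A S) := by
    refine fun S => isOpen_biUnion fun c _ => Metric.isOpen_iff.2 ?_
    rintro x ⟨r, hr, h⟩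
    refine ⟨r, hr, fun y hy => ⟨r - dist y x, sub_pos.2 hy, ?_⟩⟩
    exact ae_restrict_of_ae_restrict_of_subset (Metric.ball_subset_ball' (by linarith)) h
  have hdisj : Disjoint (A {c}) (A {c}ᶜ) := by
    rw [Set.disjoint_left]
    intro x hx hx'
    simp only [A, mem_iUnion, mem_ofPred_eq, mem_singleton_iff, mem_compl_iff,
      exists_prop, exists_eq_left] at hx hx'
    obtain ⟨r, hr, h⟩ := hx
    obtain ⟨c', hc', r', hr', h'⟩ := hx'
    have : NeZero (volume.restrict (Metric.ball x (min r r'))) :=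
      ⟨by rw [Ne, Measure.restrict_eq_zero]; exact (Metric.measure_ball_pos _ _ (lt_min hr hr')).ne'⟩
    obtain ⟨y, hy, hy'⟩ := ((ae_restrict_of_ae_restrict_of_subset
      (Metric.ball_subset_ball (min_le_left r r')) h).and (ae_restrict_of_ae_restrict_of_subset
      (Metric.ball_subset_ball (min_le_right r r')) h')).exists
    exact hc' (hy'.symm.trans hy)
  have hcover : Ω ⊆ A {c} ∪ A {c}ᶜ := by
    intro x hx
    obtain ⟨r, hr, c', -, h⟩ := hloc x hx
    by_cases hc : c' = c
    · exact Or.inl (mem_biUnion (mem_singleton_iff.2 hc) ⟨r, hr, h⟩)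
    · exact Or.inr (mem_biUnion (mem_compl hc) ⟨r, hr, h⟩)
  have hsub := hconn.isPreconnected.subset_left_of_subset_union (hopen _) (hopen _) hdisj hcover
    ⟨x₀, hx₀, mem_biUnion (mem_singleton c) ⟨r₀, hr₀, h₀⟩⟩
  refine ⟨c, ?_⟩
  rw [ae_restrict_iff' hΩ.measurableSet, ae_iff]
  refine measure_null_of_locally_null _ fun x hx => ?_
  simp only [mem_ofPred_eq, Classical.not_imp] at hx
  have hxA := hsub hx.1
  simp only [A, mem_iUnion, mem_ofPred_eq, mem_singleton_iff, exists_prop, exists_eq_left] at hxA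
  obtain ⟨r, hr, h⟩ := hxA
  rw [ae_restrict_iff' measurableSet_ball, ae_iff] at h
  refine ⟨_, inter_mem (mem_nhdsWithin_of_mem_nhds (Metric.ball_mem_nhds x hr))
    self_mem_nhdsWithin, measure_mono_null ?_ h⟩
  rintro y ⟨hy, hy'⟩
  simp only [mem_ofPred_eq, Classical.not_imp] at hy' ⊢
  exact ⟨hy, hy'.2⟩

end WeakGradient

/-! ### Energy bound and potential -/

section Equilibrium

variable {d : ℕ} {Ω : Set (EuclideanSpace ℝ (Fin d))} {ε : EuclideanSpace ℝ (Fin d) → ℝ}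
  {εlo εhi E₀ : ℝ} {σ w : ℝ → ℝ} {n p u ψ : EuclideanSpace ℝ (Fin d) → ℝ}
  {G : EuclideanSpace ℝ (Fin d) → EuclideanSpace ℝ (Fin d)}

lemma integrable_mul_norm_sq (hε_meas : AEMeasurable ε (volume.restrict Ω))
    (hε : ∀ᵐ x ∂volume.restrict Ω, ε x ∈ Icc εlo εhi) (hG : MemLp G 2 (volume.restrict Ω)) :
    IntegrableOn (fun x => ε x * ‖G x‖ ^ 2) Ω := by
  refine Integrable.bdd_mul (c := max |εlo| |εhi|) hG.norm.integrable_sq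
    hε_meas.aestronglyMeasurable (hε.mono fun x hx => ?_)
  exact abs_le_max_abs_abs hx.1 hx.2

/-- The energy of an admissible state leaves at most `E₀` for the internal energy. -/
lemma IsAdmissible.integral_le [IsFiniteMeasure (volume.restrict Ω)]
    (hε_meas : AEMeasurable ε (volume.restrict Ω)) (hεlo : 0 < εlo)
    (hε : ∀ᵐ x ∂volume.restrict Ω, ε x ∈ Icc εlo εhi) (h : IsAdmissible Ω ε E₀ n p u) :
    ∫ x in Ω, u x ≤ E₀ := by
  obtain ⟨ψ, G, hψ, hE⟩ := h.energy
  have hint := (integrable_mul_norm_sq hε_meas hε hψ.hasWeakGradient.memLp_grad).const_mul (1 / 2)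
  rw [← hE]
  refine integral_mono_ae (h.memL2_u.1.integrable one_le_two)
    ((hint.add (h.memL2_u.1.integrable one_le_two)).congr
      (Eventually.of_forall fun x => ?_)) (hε.mono fun x hx => ?_)
  · simp only [Pi.add_apply]; ring
  · have : 0 ≤ ε x := hεlo.le.trans hx.1
    have : 0 ≤ ε x / 2 * ‖G x‖ ^ 2 := by positivity
    simpa using this

lemma isAdmissible_const (hU : 0 ≤ w (E₀ / volume.real Ω)) (hE₀ : 0 < E₀)
    [IsFiniteMeasure (volume.restrict Ω)] (hΩ : 0 < volume.real Ω) :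
    IsAdmissible Ω ε E₀ (fun _ => w (E₀ / volume.real Ω)) (fun _ => w (E₀ / volume.real Ω))
      (fun _ => E₀ / volume.real Ω) where
  memL2_n := ⟨memLp_const _, Eventually.of_forall fun _ => hU⟩
  memL2_p := ⟨memLp_const _, Eventually.of_forall fun _ => hU⟩
  memL2_u := ⟨memLp_const _, Eventually.of_forall fun _ => by positivity⟩
  charge := by simp
  energy := by
    refine ⟨fun _ => 0, fun _ => 0, ⟨⟨memLp_const _, memLp_const _, ?_⟩, ?_, by simp⟩, ?_⟩
    · intros; simp
    · intros; simp
    · simp [mul_div_cancel₀ _ hΩ.ne']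

/-- A potential of a state with pointwise vanishing charge vanishes. -/
lemma IsPotential.ae_eq_zero (hΩ : IsOpen Ω) (hconn : IsConnected Ω)
    [IsFiniteMeasure (volume.restrict Ω)] (hε_meas : AEMeasurable ε (volume.restrict Ω))
    (hεlo : 0 < εlo) (hε : ∀ᵐ x ∂volume.restrict Ω, ε x ∈ Icc εlo εhi)
    (hψ : IsPotential Ω ε n p ψ G) (hnp : ∀ᵐ x ∂volume.restrict Ω, n x = p x) :
    ∀ᵐ x ∂volume.restrict Ω, ψ x = 0 := by
  -- Testing with `ψ` itself gives `∫ ε |G|² = 0`, and `ε ≥ εlo > 0` forces `G = 0`.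
  have h := hψ.weak_eq ψ G hψ.hasWeakGradient
  have h0 : ∫ x in Ω, (-n x + p x) * ψ x = 0 :=
    integral_eq_zero_of_ae (hnp.mono fun x hx => by simp [hx])
  rw [h0] at h
  simp only [real_inner_self_eq_norm_sq] at h
  rw [integral_eq_zero_iff_of_nonneg_ae
    (hε.mono fun x hx => mul_nonneg (hεlo.le.trans hx.1) (sq_nonneg _))
    (integrable_mul_norm_sq hε_meas hε hψ.hasWeakGradient.memLp_grad)] at h
  have hG : ∀ᵐ x ∂volume.restrict Ω, G x = 0 := by
    filter_upwards [h, hε] with x hx hεx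
    simpa [(hεlo.trans_le hεx.1).ne'] using hx
  obtain ⟨c, hc⟩ := hψ.hasWeakGradient.exists_ae_eq_const hΩ hconn hG
    (hψ.hasWeakGradient.memLp.integrable one_le_two)
  have hm := hψ.mean_zero
  rw [integral_congr_ae hc, setIntegral_const, smul_eq_mul] at hm
  have hpos : volume.real Ω ≠ 0 := by
    have h1 := (hΩ.measure_pos volume hconn.nonempty).ne'
    have h2 : volume Ω ≠ ⊤ := by simpa using measure_ne_top (volume.restrict Ω) univ
    exact (ENNReal.toReal_pos h1 h2).ne'
  rw [(mul_eq_zero.1 hm).resolve_left hpos] at hc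
  exact hc

end Equilibrium

end Semiconductor

theorem proposition2p2 {d : ℕ} (Ω : Set (EuclideanSpace ℝ (Fin d)))
    (hΩ_open : IsOpen Ω) (hΩ_conn : IsConnected Ω) (hΩ_bdd : Bornology.IsBounded Ω)
    (ε : EuclideanSpace ℝ (Fin d) → ℝ) (hε_meas : AEMeasurable ε (volume.restrict Ω))
    (εlo εhi : ℝ) (hεlo : 0 < εlo) (hε : ∀ᵐ x ∂volume.restrict Ω, ε x ∈ Icc εlo εhi)
    (σ w : ℝ → ℝ) (hσ : Semiconductor.IsThermalEntropy σ)
    (hw : Semiconductor.IsEquilibriumDensity w)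
    (E₀ : ℝ) (hE₀ : 0 < E₀) :
    ∃ uinf : ℝ, 0 < uinf ∧
      Semiconductor.IsEquilibrium Ω ε σ w E₀
        (fun _ => w uinf) (fun _ => w uinf) (fun _ => uinf) ∧
      ∀ n p u : EuclideanSpace ℝ (Fin d) → ℝ, Semiconductor.IsEquilibrium Ω ε σ w E₀ n p u →
        (∀ᵐ x ∂volume.restrict Ω, n x = w uinf ∧ p x = w uinf ∧ u x = uinf) ∧
        ∀ ψ G, Semiconductor.IsPotential Ω ε n p ψ G → ∀ᵐ x ∂volume.restrict Ω, ψ x = 0 := by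
  have hfin : volume Ω < ⊤ := hΩ_bdd.measure_lt_top
  have : IsFiniteMeasure (volume.restrict Ω) := ⟨by simpa using hfin⟩
  have hvol : 0 < volume.real Ω :=
    ENNReal.toReal_pos (hΩ_open.measure_pos volume hΩ_conn.nonempty).ne' hfin.ne
  set U := E₀ / volume.real Ω with hU_def
  have hU : 0 < U := div_pos hE₀ hvol
  have hadm : Semiconductor.IsAdmissible Ω ε E₀ (fun _ => w U) (fun _ => w U) (fun _ => U) :=
    Semiconductor.isAdmissible_const (hw.pos hU.le).le hE₀ hvol
  set k := deriv σ U + 2 * deriv w U with hk_def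
  have hk : 0 ≤ k := by
    have h₁ := Semiconductor.deriv_nonneg_of_strictMonoOn hσ.strictMonoOn hU
    have h₂ := Semiconductor.deriv_nonneg_of_strictMonoOn
      (hw.strictMonoOn.mono Ioi_subset_Ici_self) hU
    positivity
  set M := volume.real Ω * (σ U + 2 * w U - 2) with hM_def
  have hconst : Semiconductor.totalEntropy Ω σ w (fun _ => w U) (fun _ => w U) (fun _ => U)
      = (M : EReal) := by
    rw [Semiconductor.totalEntropy]
    simp only [Semiconductor.entropyDensity_equilibrium hU]
    rw [Semiconductor.extIntegral_coe (integrable_const _), setIntegral_const, smul_eq_mul]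
  let g : ℝ → ℝ := fun v => σ U + 2 * w U - 2 + k * (v - U)
  have hg : ∀ {n p u}, Semiconductor.IsAdmissible Ω ε E₀ n p u →
      IntegrableOn (fun x => g (u x)) Ω ∧ ∫ x in Ω, g (u x) ≤ M ∧
      ∀ᵐ x ∂volume.restrict Ω, Semiconductor.entropyDensity σ w (n x) (p x) (u x) ≤ g (u x) := by
    intro n p u h
    have hu : IntegrableOn u Ω := h.memL2_u.1.integrable one_le_two
    have hu' : IntegrableOn (fun x => k * (u x - U)) Ω := (hu.sub (integrable_const U)).const_mul k
    refine ⟨(integrable_const _).add hu', ?_, ?_⟩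
    · rw [integral_add (integrable_const _) hu', integral_const_mul,
        integral_sub hu (integrable_const _), setIntegral_const, setIntegral_const, smul_eq_mul,
        smul_eq_mul, hU_def, mul_div_cancel₀ _ hvol.ne']
      -- Only `∫ u ≤ E₀` is known, so the sign of the slope `k` matters.
      have := mul_nonneg hk (sub_nonneg.2 (h.integral_le hε_meas hεlo hε))
      linarith
    · filter_upwards [h.memL2_n.2, h.memL2_p.2, h.memL2_u.2] with x hn hp hu
      exact hσ.entropyDensity_le hw hU hn hp hu
  have hmax : sSup {s | ∃ n' p' u', Semiconductor.IsAdmissible Ω ε E₀ n' p' u' ∧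
      s = Semiconductor.totalEntropy Ω σ w n' p' u'} = (M : EReal) := by
    refine le_antisymm (sSup_le ?_) (le_sSup ⟨_, _, _, hadm, hconst.symm⟩)
    rintro _ ⟨n, p, u, h, rfl⟩
    obtain ⟨hint, hle, hae⟩ := hg h
    exact (Semiconductor.extIntegral_le_of_ae_le hint hae).trans (EReal.coe_le_coe_iff.2 hle)
  refine ⟨U, hU, ⟨hadm, hconst.trans hmax.symm⟩, fun n p u h => ?_⟩
  have had := h.admissible
  obtain ⟨hint, hle, hae⟩ := hg had
  -- A maximizer has entropy `M ≥ ∫ g(u)`, so the tangent bound is attained almost everywhere.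
  have heq := Semiconductor.ae_eq_of_integral_le_extIntegral
    (hσ.aemeasurable_entropyDensity hw had.memL2_n.1.1.aemeasurable
      had.memL2_p.1.1.aemeasurable had.memL2_u.1.1.aemeasurable had.memL2_u.2) hint hae
    ((EReal.coe_le_coe_iff.2 hle).trans (hmax.symm.trans h.eq_sSup.symm).le)
  have hval : ∀ᵐ x ∂volume.restrict Ω, n x = w U ∧ p x = w U ∧ u x = U := by
    filter_upwards [heq, had.memL2_n.2, had.memL2_p.2, had.memL2_u.2] with x hx hn hp hu
    by_contra hne
    exact (hσ.entropyDensity_lt hw hU hn hp hu hne).ne hx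
  exact ⟨hval, fun ψ G hψ => hψ.ae_eq_zero hΩ_open hΩ_conn hε_meas hεlo hε
    (hval.mono fun x hx => hx.1.trans hx.2.1.symm)⟩
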